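/- Let $G$ and $H$ be finite undirected multigraphs (loops and parallel edges are allowed; connectedness is not assumed). For such a graph $G$ with vertex set $V$, regard each edge as a pair of directed edges with opposite orientations (a loop representing two directed loops), let $A_{vw}$ be the number of directed edges from $v$ to $w$, let $\Delta$ be the diagonal matrix with $\Delta_{vv}=\sum_{w\in V}A_{vw}$, and let $Q(G)=\Delta-A$ be the Laplacian matrix. The reduced critical group $K(G)$ is the torsion subgroup of $\mathbf{Z}^{V}/Q(G)^{\dagger}\mathbf{Z}^{V}$, where ${}^{\dagger}$ denotes the transpose. The graphic matroid of $G$ is the matroid on the edge set of $G$ whose independent sets are the sets of edges that contain no cycle (a loop is a cycle, and so is a pair of parallel edges). If the graphic matroids of $G$ and $H$ are isomorphic, then $K(G)\simeq K(H)$ as abelian groups. -/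

import Mathlib

noncomputable section

namespace Graph

universe u v

variable {α : Type u} {β : Type v}

/-! ### The critical group of an undirected multigraph -/

open Classical in
/-- The adjacency matrix of a finite undirected multigraph.  Each edge represents a pair of directed
edges with opposite orientations, and the `(x, y)`-entry is the number of directed edges from `x`
to `y`.  So an edge with distinct ends `x, y` contributes `1` to the entries `(x, y)` and `(y, x)`,
and a loop at `x`, representing two directed loops, contributes `2` to the entry `(x, x)`. -/
def adjacencyMatrix (G : Graph α β) : Matrix G.vertexSet G.vertexSet ℤ :=
  Matrix.of fun x y =>
    if x = y then 2 * ({e | G.IsLoopAt e x}.ncard : ℤ) else ({e | G.IsLink e x y}.ncard : ℤ)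

open Classical in
/-- The Laplacian matrix `Δ - A`, where `Δ` is the diagonal matrix of outdegrees, that is, of row
sums of the adjacency matrix `A`. -/
def laplacianMatrix (G : Graph α β) [Fintype G.vertexSet] : Matrix G.vertexSet G.vertexSet ℤ :=
  Matrix.diagonal (fun x => ∑ y, G.adjacencyMatrix x y) - G.adjacencyMatrix

/-- The (full) critical group: the cokernel of the transpose of the Laplacian matrix acting on
column vectors in `ℤ^V`. -/
abbrev CriticalGroup (G : Graph α β) [Fintype G.vertexSet] : Type u :=
  (G.vertexSet → ℤ) ⧸ LinearMap.range G.laplacianMatrix.transpose.mulVecLin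

/-- The reduced critical group: the subgroup of the critical group consisting of all elements of
finite order. -/
abbrev ReducedCriticalGroup (G : Graph α β) [Fintype G.vertexSet] : Type u :=
  AddCommGroup.torsion G.CriticalGroup

/-! ### The graphic matroid -/

/-- `C` is the edge set of a cycle: there are distinct vertices `v 0, …, v k` and distinct edges
`e 0, …, e k` such that `e i` has ends `v i` and `v (i + 1)`, indices being read modulo `k + 1`.
In particular a loop is a cycle (`k = 0`), and so is a pair of parallel edges (`k = 1`). -/
def IsCycleSet (G : Graph α β) (C : Set β) : Prop :=
  ∃ (k : ℕ) (v : Fin (k + 1) → α) (e : Fin (k + 1) → β),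
    Function.Injective v ∧ Function.Injective e ∧
      (∀ i, G.IsLink (e i) (v i) (v (i + 1))) ∧ C = Set.range e

/-- A set of edges is a forest if it contains no edge set of a cycle. -/
def IsForest (G : Graph α β) (I : Set β) : Prop :=
  I ⊆ G.edgeSet ∧ ∀ C ⊆ I, ¬ G.IsCycleSet C

open Classical in
/-- The incidence vector of an edge modulo two, used only to verify the matroid axioms. -/
def incVec (G : Graph α β) (e : β) : α →₀ ZMod 2 :=
  if h : ∃ p : α × α, G.IsLink e p.1 p.2 then
    Finsupp.single h.choose.1 1 + Finsupp.single h.choose.2 1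
  else 0

theorem IsLink.incVec_eq {G : Graph α β} {e : β} {x y : α} (h : G.IsLink e x y) :
    G.incVec e = Finsupp.single x 1 + Finsupp.single y 1 := by
  have hex : ∃ p : α × α, G.IsLink e p.1 p.2 := ⟨(x, y), h⟩
  rw [incVec, dif_pos hex]
  obtain ⟨h1, h2⟩ | ⟨h1, h2⟩ := hex.choose_spec.eq_and_eq_or_eq_and_eq h
  · rw [h1, h2]
  · rw [h1, h2, add_comm]

/-- A nonempty finite set of edges in which every end of every edge is an end of another edge
contains a cycle. -/
theorem exists_isCycleSet_of_forall_exists_ne {G : Graph α β} {S : Set β} (hS : S.Finite)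
    (hne : S.Nonempty) (hE : S ⊆ G.edgeSet)
    (h : ∀ a ∈ S, ∀ x y, G.IsLink a x y → x ≠ y → ∃ b ∈ S, b ≠ a ∧ G.Inc b y) :
    ∃ C ⊆ S, G.IsCycleSet C := by
  classical
  by_contra! hcon
  have hloop : ∀ a ∈ S, ∀ x y, G.IsLink a x y → x ≠ y := by
    rintro a ha x y hl rfl
    refine hcon {a} (by simpa using ha) ⟨0, fun _ => x, fun _ => a,
      fun s t _ => Fin.ext (by omega), fun s t _ => Fin.ext (by omega),
      fun _ => hl, by simp⟩
  let T := {p : β × α × α // p.1 ∈ S ∧ G.IsLink p.1 p.2.1 p.2.2}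
  have hstep : ∀ t : T, ∃ t' : T, t'.1.1 ≠ t.1.1 ∧ t'.1.2.1 = t.1.2.2 := by
    rintro ⟨⟨a, x, y⟩, ha, hl⟩
    obtain ⟨b, hb, hba, z, hz⟩ := h a ha x y hl (hloop a ha x y hl)
    exact ⟨⟨(b, y, z), hb, hz⟩, hba, rfl⟩
  obtain ⟨a0, ha0⟩ := hne
  obtain ⟨x0, y0, hl0⟩ := G.exists_isLink_of_mem_edgeSet (hE ha0)
  choose nxt hnxt1 hnxt2 using hstep
  let f : ℕ → T := fun n => Nat.rec ⟨(a0, x0, y0), ha0, hl0⟩ (fun _ t => nxt t) n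
  let w : ℕ → α := fun n => (f n).1.2.1
  let d : ℕ → β := fun n => (f n).1.1
  have hdS : ∀ n, d n ∈ S := fun n => (f n).2.1
  have hlink : ∀ n, G.IsLink (d n) (w n) (w (n + 1)) := by
    intro n
    have h1 := (f n).2.2
    have h2 : w (n + 1) = (f n).1.2.2 := hnxt2 (f n)
    rw [h2]
    exact h1
  have hd : ∀ n, d (n + 1) ≠ d n := fun n => hnxt1 (f n)
  have hX : (⋃ a ∈ S, {x | G.Inc a x}).Finite := by
    refine hS.biUnion fun a ha => ?_
    obtain ⟨x, y, hl⟩ := G.exists_isLink_of_mem_edgeSet (hE ha)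
    refine (Set.toFinite {x, y}).subset fun z hz => ?_
    simpa using hz.eq_or_eq_of_isLink hl
  have hwX : ∀ n, w n ∈ ⋃ a ∈ S, {x | G.Inc a x} := fun n =>
    Set.mem_biUnion (hdS n) (hlink n).inc_left
  have hrep : ∃ k i, w i = w (i + k + 1) := by
    obtain ⟨i, -, j, -, hij, hw⟩ := Set.infinite_univ.exists_lt_map_eq_of_mapsTo
      (fun n _ => hwX n) hX
    exact ⟨j - i - 1, i, by rw [hw, show i + (j - i - 1) + 1 = j by omega]⟩
  obtain ⟨i, hi⟩ := Nat.find_spec hrep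
  set k := Nat.find hrep with hk
  have hmin : ∀ a b, a < b → w a = w b → k ≤ b - a - 1 := by
    intro a b hab hw
    refine Nat.find_min' hrep ⟨a, ?_⟩
    rw [hw, show a + (b - a - 1) + 1 = b by omega]
  have hdinj : ∀ a b, a < b → b ≤ a + k → d a ≠ d b := by
    intro a b hab hbk hdab
    have h1 := hlink a
    rw [hdab] at h1
    obtain ⟨h2, -⟩ | ⟨h2, h3⟩ := h1.eq_and_eq_or_eq_and_eq (hlink b)
    · have := hmin a b hab h2
      omega
    · by_cases hb : b = a + 1
      · exact hd a (by rw [hdab, hb])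
      · have := hmin (a + 1) b (by omega) h3
        omega
  refine hcon (Set.range fun t : Fin (k + 1) => d (i + t)) ?_
    ⟨k, fun t => w (i + t), fun t => d (i + t), ?_, ?_, ?_, rfl⟩
  · rintro _ ⟨t, rfl⟩
    exact hdS _
  · intro s t hst
    by_contra hne
    rcases lt_or_gt_of_ne (fun h => hne (Fin.ext h) : (s : ℕ) ≠ t) with hlt | hlt
    · have := hmin (i + s) (i + t) (by omega) hst
      omega
    · have := hmin (i + t) (i + s) (by omega) hst.symm
      omega
  · intro s t hst
    by_contra hne
    rcases lt_or_gt_of_ne (fun h => hne (Fin.ext h) : (s : ℕ) ≠ t) with hlt | hlt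
    · exact hdinj (i + s) (i + t) (by omega) (by omega) hst
    · exact hdinj (i + t) (i + s) (by omega) (by omega) hst.symm
  · intro t
    change G.IsLink (d (i + t)) (w (i + t)) (w (i + ((t + 1 : Fin (k + 1)) : ℕ)))
    have h1 := hlink (i + t)
    by_cases ht : t = Fin.last k
    · subst ht
      have h2 : w (i + ((Fin.last k + 1 : Fin (k + 1)) : ℕ)) = w (i + (Fin.last k : ℕ) + 1) := by
        simpa using hi
      rw [h2]
      exact h1
    · rw [Fin.val_add_one, if_neg ht]
      exact h1

/-- The forests are the sets of edges whose incidence vectors modulo two are independent. -/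
theorem isForest_iff {G : Graph α β} {I : Set β} :
    G.IsForest I ↔ I ⊆ G.edgeSet ∧ LinearIndepOn (ZMod 2) G.incVec I := by
  classical
  refine and_congr_right fun hE => ⟨fun h => ?_, fun h => ?_⟩
  · rw [linearIndepOn_iff]
    intro l hl hsum
    by_contra hl0
    have hsupp : (l.support : Set β) ⊆ I := hl
    obtain ⟨C, hC, hcyc⟩ := exists_isCycleSet_of_forall_exists_ne (G := G)
      (S := l.support) l.support.finite_toSet
      (by simpa using Finsupp.support_nonempty_iff.2 hl0) (hsupp.trans hE) (by
        intro a ha x y hl hxy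
        by_contra! hcon
        have hy := DFunLike.congr_fun hsum y
        rw [Finsupp.linearCombination_apply, Finsupp.sum, Finsupp.finsetSum_apply,
          Finset.sum_eq_single a] at hy
        · simp only [Finsupp.smul_apply, hl.incVec_eq] at hy
          simp [hxy] at hy
          exact (Finsupp.mem_support_iff.1 ha) hy
        · intro b hb hba
          obtain ⟨p, q, hpq⟩ := G.exists_isLink_of_mem_edgeSet (hE (hsupp hb))
          have hby := hcon b hb hba
          have hpy : p ≠ y := fun h => hby (h ▸ hpq.inc_left)
          have hqy : q ≠ y := fun h => hby (h ▸ hpq.inc_right)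
          simp [hpq.incVec_eq, hpy, hqy]
        · intro hna
          exact absurd ha hna)
    exact h C (hC.trans hsupp) hcyc
  · rintro C hC ⟨k, v, e, -, he, hlink, rfl⟩
    have hli : LinearIndependent (ZMod 2) (fun i => G.incVec (e i)) := by
      have h1 : LinearIndepOn (ZMod 2) G.incVec (Set.range e) := h.mono hC
      exact (linearIndepOn_range_iff he G.incVec).1 h1
    rw [Fintype.linearIndependent_iff] at hli
    have h0 := hli (fun _ => 1) (by
      have hs : ∑ i, Finsupp.single (v (i + 1)) (1 : ZMod 2) = ∑ i, Finsupp.single (v i) 1 :=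
        Equiv.sum_comp (Equiv.addRight (1 : Fin (k + 1)))
          (fun i => Finsupp.single (v i) (1 : ZMod 2))
      have hi : ∀ i, (1 : ZMod 2) • G.incVec (e i) =
          Finsupp.single (v i) 1 + Finsupp.single (v (i + 1)) 1 := fun i => by
        rw [one_smul, (hlink i).incVec_eq]
      rw [Finset.sum_congr rfl fun i _ => hi i, Finset.sum_add_distrib, hs]
      ext x
      rw [Finsupp.add_apply]
      exact CharTwo.add_self_eq_zero _) 0
    exact one_ne_zero h0

/-- The graphic matroid: its ground set is the set of edges and its independent sets are the
forests. -/
def graphicMatroid (G : Graph α β) : Matroid β :=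
  (IndepMatroid.ofFinitaryCardAugment G.edgeSet G.IsForest
    ⟨by simp, by
      rintro C hC ⟨k, v, e, -, -, -, rfl⟩
      exact hC ⟨0, rfl⟩⟩
    (fun I J hJ hIJ => ⟨hIJ.trans hJ.1, fun C hC => hJ.2 C (hC.trans hIJ)⟩)
    (by
      intro I J hI hIfin hJ hJfin hlt
      rw [isForest_iff] at hI hJ
      by_contra! hcon
      have hle : Submodule.span (ZMod 2) (G.incVec '' J) ≤
          Submodule.span (ZMod 2) (G.incVec '' I) := by
        rw [Submodule.span_le]
        rintro _ ⟨a, ha, rfl⟩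
        by_contra hna
        have haI : a ∉ I := fun h => hna (Submodule.subset_span ⟨a, h, rfl⟩)
        refine hcon a ha haI (isForest_iff.2 ⟨Set.insert_subset (hJ.1 ha) hI.1, ?_⟩)
        exact hI.2.insert hna
      have := hIfin.to_subtype
      have := hJfin.to_subtype
      have hcard : ∀ K : Set β, K.Finite → LinearIndepOn (ZMod 2) G.incVec K →
          Module.finrank (ZMod 2) (Submodule.span (ZMod 2) (G.incVec '' K)) = K.ncard := by
        intro K hKfin hK
        have := hKfin.fintype
        have h1 := finrank_span_eq_card (R := ZMod 2) hK
        rw [← Nat.card_eq_fintype_card, Nat.card_coe_set_eq] at h1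
        rw [← h1, Set.image_eq_range]
      have := FiniteDimensional.span_of_finite (ZMod 2) (hIfin.image G.incVec)
      have h1 := Submodule.finrank_mono hle
      rw [hcard I hIfin hI.2, hcard J hJfin hJ.2] at h1
      omega)
    (by
      intro I hI
      refine ⟨fun a ha => (hI {a} (by simpa using ha) (Set.finite_singleton a)).1 rfl, ?_⟩
      rintro C hC ⟨k, v, e, hv, he, hlink, rfl⟩
      exact (hI _ hC (Set.finite_range e)).2 _ subset_rfl ⟨k, v, e, hv, he, hlink, rfl⟩)
    (fun _ hI => hI.1)).matroid

@[simp] theorem graphicMatroid_ground (G : Graph α β) : G.graphicMatroid.E = G.edgeSet := rfl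

@[simp] theorem graphicMatroid_indep (G : Graph α β) {I : Set β} :
    G.graphicMatroid.Indep I ↔ G.IsForest I := Iff.rfl

end Graph

namespace Matroid

/-- Two matroids are isomorphic if some bijection between their ground sets preserves independence
of sets in both directions. -/
def IsIsomorphic {α β : Type*} (M : Matroid α) (N : Matroid β) : Prop :=
  ∃ φ : M.E ≃ N.E, ∀ I : Set M.E,
    M.Indep (Subtype.val '' I) ↔ N.Indep (Subtype.val '' (φ '' I))

end Matroid

end

/-! Orient the edges and let `D` be the vertex-edge incidence matrix, so that the Laplacian is `D *
Dᵀ`. Forests have integral potentials, and every non-forest supports a signed cycle in `ker D`;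
these two facts (`IsUnimodularRep`) are all that is used of the graph.

They imply that the image of `D` is saturated in `ℤ^V`. Hence `D` identifies the torsion of `ℤ^E /
(ker D + im Dᵀ)` with that of `ℤ^V / im (D * Dᵀ)`. Moreover `im Dᵀ` is the orthogonal complement of
`ker D`, so everything is determined by the lattice `ker D`.

It remains to see that the matroid determines `ker D` up to changing signs of coordinates (unique
representability of regular matroids). Relative to a basis `T`, `ker D` is the graph of a matrix
with entries `0, ±1`, and the matroid decides which sets of its columns become dependent on which
sets of rows. Two such matrices with the same dependences differ by signs of rows and columns: after
matching all earlier columns, an inconsistent sign in a new column gives a shortest, hence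
chordless, cycle in the bipartite row-column graph, and the submatrix on it is singular for only one
of the two sign products. The resulting diagonal sign matrix is an isometry of `ℤ^E`, so it respects
kernels and their orthogonal complements. -/

/-! ### Sign patterns determined by vanishing minors -/

namespace Matrix

variable {R S : Type*}

/-- Some nonzero combination of the columns in `X` vanishes on the rows in `Y`. -/
def ColumnsDependent [Fintype S] (a : Matrix R S ℤ) (Y : Set R) (X : Set S) : Prop :=
  ∃ c : S → ℤ, c ≠ 0 ∧ (∀ t ∉ X, c t = 0) ∧ ∀ r ∈ Y, ∑ t, c t * a r t = 0

/-- A solution of the linear recursion cutting out the kernel of a path matrix. -/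
def pathVec (a : Matrix R S ℤ) (r : ℕ → R) (s : ℕ → S) : ℕ → ℤ
  | 0 => 1
  | j + 1 => -(pathVec a r s j * a (r (j + 1)) (s j) * a (r (j + 1)) (s (j + 1)))

theorem pathVec_mul_self {a : Matrix R S ℤ} {r : ℕ → R} {s : ℕ → S} {k : ℕ}
    (h1 : ∀ j < k, a (r j) (s j) * a (r j) (s j) = 1)
    (h2 : ∀ j < k, a (r (j + 1)) (s j) * a (r (j + 1)) (s j) = 1) :
    ∀ j < k, pathVec a r s j * pathVec a r s j = 1
  | 0, _ => rfl
  | j + 1, hj => by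
    have h := pathVec_mul_self h1 h2 j (by omega)
    have h3 := h1 (j + 1) hj
    have h4 := h2 j (by omega)
    simp only [pathVec]
    linear_combination (a (r (j + 1)) (s j) * a (r (j + 1)) (s j) *
      (a (r (j + 1)) (s (j + 1)) * a (r (j + 1)) (s (j + 1)))) * h +
      (a (r (j + 1)) (s (j + 1)) * a (r (j + 1)) (s (j + 1))) * h4 + h3

/-- The square matrix of a chordless cycle is singular exactly for one of the two possible
products of signs. -/
theorem columnsDependent_cycle_iff [Fintype S] {a : Matrix R S ℤ} {r : ℕ → R} {s : ℕ → S} {u : S}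
    {k : ℕ}
    (h1 : ∀ j < k + 1, a (r j) (s j) * a (r j) (s j) = 1)
    (h2 : ∀ j < k + 1, a (r (j + 1)) (s j) * a (r (j + 1)) (s j) = 1)
    (h0 : ∀ i j, i ≤ k + 1 → j < k + 1 → i ≠ j → i ≠ j + 1 → a (r i) (s j) = 0)
    (hu : ∀ i, 0 < i → i < k + 1 → a (r i) u = 0)
    (hu0 : a (r 0) u * a (r 0) u = 1) (hne : ∀ j < k + 1, s j ≠ u) :
    ColumnsDependent a (r '' Set.Iic (k + 1)) (insert u (s '' Set.Iio (k + 1))) ↔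
      a (r (k + 1)) u =
        a (r 0) u * a (r 0) (s 0) * (pathVec a r s k * a (r (k + 1)) (s k)) := by
  classical
  have hx := pathVec_mul_self h1 h2
  -- A repeated column `s i = s j` with `i < j` would have at row `r i` both an entry `±1` and, by
  -- chordlessness, an entry `0`. With this each row sum below reduces to two terms.
  have hsinj : ∀ i j, i < k + 1 → j < k + 1 → s i = s j → i = j := by
    have key : ∀ i j, i < k + 1 → j < k + 1 → s i = s j → ¬ i < j := by
      intro i j hi hj hij hlt
      have h3 := h0 i j (by omega) hj (by omega) (by omega)
      have h4 := h1 i hi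
      rw [hij, h3] at h4
      simp at h4
    intro i j hi hj hij
    have := key i j hi hj hij
    have := key j i hj hi hij.symm
    omega
  have sum0 : ∀ c : S → ℤ, (∀ t ∉ insert u (s '' Set.Iio (k + 1)), c t = 0) →
      ∑ t, c t * a (r 0) t = c (s 0) * a (r 0) (s 0) + c u * a (r 0) u := by
    intro c hc
    refine Fintype.sum_eq_add _ _ (hne 0 (by omega)) ?_
    rintro t ⟨ht0, htu⟩
    by_cases ht : t ∈ insert u (s '' Set.Iio (k + 1))
    · obtain rfl | ⟨j, hj, rfl⟩ := ht
      · exact absurd rfl htu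
      · have hj0 : j ≠ 0 := fun h => ht0 (by rw [h])
        rw [h0 0 j (by omega) hj (by omega) (by omega), mul_zero]
    · rw [hc t ht, zero_mul]
  have sumk : ∀ c : S → ℤ, (∀ t ∉ insert u (s '' Set.Iio (k + 1)), c t = 0) →
      ∑ t, c t * a (r (k + 1)) t =
        c (s k) * a (r (k + 1)) (s k) + c u * a (r (k + 1)) u := by
    intro c hc
    refine Fintype.sum_eq_add _ _ (hne k (by omega)) ?_
    rintro t ⟨ht0, htu⟩
    by_cases ht : t ∈ insert u (s '' Set.Iio (k + 1))
    · obtain rfl | ⟨j, hj, rfl⟩ := ht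
      · exact absurd rfl htu
      · have hjk : j ≠ k := fun h => ht0 (by rw [h])
        have hj' : j < k + 1 := hj
        rw [h0 (k + 1) j (by omega) hj (by omega) (by omega), mul_zero]
    · rw [hc t ht, zero_mul]
  have sumi : ∀ c : S → ℤ, (∀ t ∉ insert u (s '' Set.Iio (k + 1)), c t = 0) → ∀ i < k,
      ∑ t, c t * a (r (i + 1)) t =
        c (s i) * a (r (i + 1)) (s i) + c (s (i + 1)) * a (r (i + 1)) (s (i + 1)) := by
    intro c hc i hi
    refine Fintype.sum_eq_add _ _ (fun h => ?_) ?_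
    · have := hsinj i (i + 1) (by omega) (by omega) h
      omega
    rintro t ⟨ht0, ht1⟩
    by_cases ht : t ∈ insert u (s '' Set.Iio (k + 1))
    · obtain rfl | ⟨j, hj, rfl⟩ := ht
      · rw [hu (i + 1) (by omega) (by omega), mul_zero]
      · have hj0 : j ≠ i := fun h => ht0 (by rw [h])
        have hj1 : j ≠ i + 1 := fun h => ht1 (by rw [h])
        rw [h0 (i + 1) j (by omega) hj (by omega) (by omega), mul_zero]
    · rw [hc t ht, zero_mul]
  have h10 := h1 0 (by omega)
  have hxk := hx k (by omega)
  have h2k := h2 k (by omega)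
  constructor
  · rintro ⟨c, hc0, hc, hcr⟩
    have e0 := sum0 c hc
    rw [hcr _ ⟨0, by simp, rfl⟩] at e0
    have ek := sumk c hc
    rw [hcr _ ⟨k + 1, by simp, rfl⟩] at ek
    -- The interior rows propagate the coefficient from `s 0`, each nonzero entry being its own
    -- inverse. Row `r 0` then ties `c (s 0)` to `c u`, and the last row is the closing condition.
    have ej : ∀ j < k + 1, c (s j) = c (s 0) * pathVec a r s j := by
      intro j
      induction j with
      | zero => simp [pathVec]
      | succ j ih =>
        intro hj
        have ei := sumi c hc j (by omega)
        rw [hcr _ ⟨j + 1, by simpa using hj.le, rfl⟩, ih (by omega)] at ei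
        simp only [pathVec]
        linear_combination (-a (r (j + 1)) (s (j + 1))) * ei - c (s (j + 1)) * h1 (j + 1) hj
    rw [ej k (by omega)] at ek
    have hcs : c (s 0) = -(c u * a (r 0) u * a (r 0) (s 0)) := by
      linear_combination (-a (r 0) (s 0)) * e0 - c (s 0) * h10
    have hcu : c u ≠ 0 := by
      intro hcu
      refine hc0 (funext fun t => ?_)
      by_cases ht : t ∈ insert u (s '' Set.Iio (k + 1))
      · obtain rfl | ⟨j, hj, rfl⟩ := ht
        · exact hcu
        · rw [ej j hj, hcs, hcu]; simp
      · exact hc t ht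
    refine mul_left_cancel₀ hcu ?_
    rw [hcs] at ek
    linear_combination -ek
  · intro hak
    -- The coefficient at `s 0` that row `r 0` forces once the coefficient at `u` is `1`.
    let l : ℤ := -(a (r 0) u * a (r 0) (s 0))
    let c : S → ℤ := fun t => if t = u then 1 else
      if h : ∃ j < k + 1, s j = t then l * pathVec a r s h.choose else 0
    have hcu : c u = 1 := by simp [c]
    have hcs : ∀ j < k + 1, c (s j) = l * pathVec a r s j := by
      intro j hj
      have hex : ∃ i < k + 1, s i = s j := ⟨j, hj, rfl⟩
      have := hsinj _ _ hex.choose_spec.1 hj hex.choose_spec.2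
      simp only [c]
      rw [if_neg (hne j hj), dif_pos hex, this]
    have hc : ∀ t ∉ insert u (s '' Set.Iio (k + 1)), c t = 0 := by
      intro t ht
      simp only [Set.mem_insert_iff, Set.mem_image, Set.mem_Iio, not_or] at ht
      simp only [c]
      rw [if_neg ht.1, dif_neg ht.2]
    refine ⟨c, fun h => ?_, hc, ?_⟩
    · rw [h] at hcu
      simp at hcu
    · rintro _ ⟨i, hi, rfl⟩
      have hi' : i ≤ k + 1 := hi
      rcases i with _ | i
      · rw [sum0 c hc, hcu, hcs 0 (by omega)]
        simp only [l, pathVec]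
        linear_combination (-a (r 0) u) * h10
      · by_cases hik : i = k
        · subst hik
          rw [sumk c hc, hcu, hcs i (by omega), hak]
          simp only [l]
          ring
        · rw [sumi c hc i (by omega), hcs i (by omega), hcs (i + 1) (by omega)]
          simp only [pathVec]
          linear_combination (-(l * pathVec a r s i * a (r (i + 1)) (s i))) *
            h1 (i + 1) (by omega)

theorem pathVec_congr {a b : Matrix R S ℤ} {r : ℕ → R} {s : ℕ → S} {k : ℕ}
    (h : ∀ j < k + 1, ∀ i, a i (s j) = b i (s j)) :
    ∀ j < k + 1, pathVec a r s j = pathVec b r s j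
  | 0, _ => rfl
  | j + 1, hj => by
    simp only [pathVec]
    rw [pathVec_congr h j (by omega), h j (by omega), h (j + 1) hj]

/-- The rows `r 0, …, r k` are successively joined by columns in `X`. -/
def IsRowChain (a : Matrix R S ℤ) (X : Set S) (k : ℕ) (r : ℕ → R) (s : ℕ → S) : Prop :=
  ∀ j < k, s j ∈ X ∧ a (r j) (s j) ≠ 0 ∧ a (r (j + 1)) (s j) ≠ 0

/-- If two matrices with entries `0, ±1` and the same vanishing minors agree on the columns in `X`,
then the ratio of their entries in another column is constant along chains of rows joined by
columns in `X`. -/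
theorem not_exists_isRowChain_of_ratio_ne [Fintype S] {a b : Matrix R S ℤ} {X : Set S} {u : S}
    (ha : ∀ r t, a r t ≠ 0 → a r t * a r t = 1)
    (h : ∀ Y Z, ColumnsDependent a Y Z ↔ ColumnsDependent b Y Z)
    (hab : ∀ t ∈ X, ∀ r, a r t = b r t) (huX : u ∉ X)
    (hbu : ∀ r, b r u = a r u ∨ b r u = -a r u) :
    ¬ ∃ k r s, IsRowChain a X k r s ∧ a (r 0) u ≠ 0 ∧ b (r 0) u = a (r 0) u ∧
      a (r k) u ≠ 0 ∧ b (r k) u = -a (r k) u := by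
  classical
  intro hex
  -- A shortest chain from a row with ratio `1` to a row with ratio `-1`. Minimality makes column
  -- `u` vanish on interior rows (`hu`) and excludes chords (`hz`).
  obtain ⟨r, s, hch, h0, h0', hk, hk'⟩ := Nat.find_spec hex
  set k := Nat.find hex with hkdef
  have hmin : ∀ k' r s, IsRowChain a X k' r s → a (r 0) u ≠ 0 → b (r 0) u = a (r 0) u →
      a (r k') u ≠ 0 → b (r k') u = -a (r k') u → k ≤ k' := fun k' r s h1 h2 h3 h4 h5 =>
    Nat.find_min' hex ⟨r, s, h1, h2, h3, h4, h5⟩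
  obtain ⟨m, hm⟩ : ∃ m, k = m + 1 := by
    refine Nat.exists_eq_succ_of_ne_zero fun hk0 => ?_
    rw [hk0] at hk'
    omega
  clear_value k
  subst hm
  have hu : ∀ i, 0 < i → i < m + 1 → a (r i) u = 0 := by
    intro i hi hik
    by_contra hne
    obtain h1 | h1 := hbu (r i)
    · have := hmin (m + 1 - i) (fun n => r (i + n)) (fun n => s (i + n)) (fun j hj =>
        hch (i + j) (by omega)) hne h1
        (by rw [show i + (m + 1 - i) = m + 1 by omega]; exact hk)
        (by rw [show i + (m + 1 - i) = m + 1 by omega]; exact hk')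
      omega
    · have := hmin i r s (fun j hj => hch j (by omega)) h0 h0' hne h1
      omega
  have hz : ∀ i j, i ≤ m + 1 → j < m + 1 → i ≠ j → i ≠ j + 1 → a (r i) (s j) = 0 := by
    intro i j hi hj hij hij'
    by_contra hne
    rcases lt_or_gt_of_ne hij with hlt | hlt
    -- A chord with `i < j` joins `r i` directly to `r (j + 1)` through `s j`, saving `j - i` steps.
    · have := hmin (m + 1 - (j - i)) (fun n => if n ≤ i then r n else r (n + (j - i)))
        (fun n => if n < i then s n else s (n + (j - i))) (by
          intro n hn
          rcases lt_trichotomy n i with hni | rfl | hni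
          · simpa [hni, hni.le, Nat.succ_le_of_lt hni] using hch n (by omega)
          · have e1 : n + (j - n) = j := by omega
            have e2 : n + 1 + (j - n) = j + 1 := by omega
            simp only [le_refl, if_true, lt_irrefl, if_false, e1, e2,
              show ¬ n + 1 ≤ n by omega]
            exact ⟨(hch j hj).1, hne, (hch j hj).2.2⟩
          · simp only [show ¬ n ≤ i by omega, show ¬ n < i by omega, show ¬ n + 1 ≤ i by omega,
              if_false, show n + 1 + (j - i) = n + (j - i) + 1 by omega]
            exact hch (n + (j - i)) (by omega))
        (by simpa using h0) (by simpa using h0')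
        (by simpa [show ¬ m + 1 - (j - i) ≤ i by omega,
          show m + 1 - (j - i) + (j - i) = m + 1 by omega] using hk)
        (by simpa [show ¬ m + 1 - (j - i) ≤ i by omega,
          show m + 1 - (j - i) + (j - i) = m + 1 by omega] using hk')
      omega
    -- A chord with `j + 1 < i` joins `r j` directly to `r i` through `s j`, saving `i - j - 1`
    -- steps.
    · have := hmin (m + 1 - (i - j - 1)) (fun n => if n ≤ j then r n else r (n + (i - j - 1)))
        (fun n => if n ≤ j then s n else s (n + (i - j - 1))) (by
          intro n hn
          rcases lt_trichotomy n j with hni | rfl | hni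
          · simpa [hni, hni.le, Nat.succ_le_of_lt hni] using hch n (by omega)
          · have e2 : n + 1 + (i - n - 1) = i := by omega
            simp only [le_refl, if_true, if_false, e2, show ¬ n + 1 ≤ n by omega]
            exact ⟨(hch n hj).1, (hch n hj).2.1, hne⟩
          · simp only [show ¬ n ≤ j by omega, show ¬ n + 1 ≤ j by omega,
              if_false, show n + 1 + (i - j - 1) = n + (i - j - 1) + 1 by omega]
            exact hch (n + (i - j - 1)) (by omega))
        (by simpa using h0) (by simpa using h0')
        (by simpa [show ¬ m + 1 - (i - j - 1) ≤ j by omega,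
          show m + 1 - (i - j - 1) + (i - j - 1) = m + 1 by omega] using hk)
        (by simpa [show ¬ m + 1 - (i - j - 1) ≤ j by omega,
          show m + 1 - (i - j - 1) + (i - j - 1) = m + 1 by omega] using hk')
      omega
  have hX : ∀ j < m + 1, s j ∈ X := fun j hj => (hch j hj).1
  have hne : ∀ j < m + 1, s j ≠ u := fun j hj hju => huX (hju ▸ hX j hj)
  have h1 : ∀ j < m + 1, a (r j) (s j) * a (r j) (s j) = 1 := fun j hj =>
    ha _ _ (hch j hj).2.1
  have h2 : ∀ j < m + 1, a (r (j + 1)) (s j) * a (r (j + 1)) (s j) = 1 := fun j hj =>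
    ha _ _ (hch j hj).2.2
  have hcol : ∀ j < m + 1, ∀ i, a i (s j) = b i (s j) := fun j hj => hab _ (hX j hj)
  have ea := columnsDependent_cycle_iff (u := u) h1 h2 hz hu (ha _ _ h0) hne
  have eb := columnsDependent_cycle_iff (a := b) (r := r) (s := s) (u := u) (k := m)
    (fun j hj => by simpa only [hcol j hj] using h1 j hj)
    (fun j hj => by simpa only [hcol j hj] using h2 j hj)
    (fun i j hi hj => by simpa only [hcol j hj] using hz i j hi hj)
    (fun i hi hi' => by simpa [hu i hi hi'] using hbu (r i)) (by rw [h0']; exact ha _ _ h0) hne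
  -- Both cycles have the same critical value for the last entry in column `u`, but those entries
  -- are opposite signs: exactly one of the two submatrices is singular, which is the contradiction.
  rw [h0', hk', ← hcol 0 (by omega), ← hcol m (by omega), ← pathVec_congr hcol m (by omega),
    ← h, ea] at eb
  have hsq : (a (r 0) u * a (r 0) (s 0) * (pathVec a r s m * a (r (m + 1)) (s m))) ^ 2 = 1 := by
    have e1 := ha _ _ h0
    have e2 := h1 0 (by omega)
    have e3 := pathVec_mul_self h1 h2 m (by omega)
    have e4 := h2 m (by omega)
    calc _ = (a (r 0) u * a (r 0) u) * (a (r 0) (s 0) * a (r 0) (s 0)) *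
          ((pathVec a r s m * pathVec a r s m) *
          (a (r (m + 1)) (s m) * a (r (m + 1)) (s m))) := by ring
      _ = 1 := by rw [e1, e2, e3, e4]; norm_num
  have hk1 : a (r (m + 1)) u ^ 2 = 1 := by rw [sq]; exact ha _ _ hk
  generalize a (r 0) u * a (r 0) (s 0) * (pathVec a r s m * a (r (m + 1)) (s m)) = x at eb hsq
  rcases sq_eq_one_iff.1 hk1 with h5 | h5 <;>
    rcases sq_eq_one_iff.1 hsq with h6 | h6 <;> rw [h5, h6] at eb <;> simp at eb

/-! ### Sign rescaling and induction on the columns -/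

theorem ColumnsDependent.singleton_iff [Fintype S] {a : Matrix R S ℤ} {r : R} {u : S} :
    ColumnsDependent a {r} {u} ↔ a r u = 0 := by
  classical
  constructor
  · rintro ⟨c, hc0, hc, hcr⟩
    have h2 := hcr _ rfl
    rw [Fintype.sum_eq_single u (fun t ht => by rw [hc t ht, zero_mul])] at h2
    refine (mul_eq_zero.1 h2).resolve_left fun hu => hc0 (funext fun t => ?_)
    by_cases htu : t = u
    · rw [htu]
      exact hu
    · exact hc t htu
  · intro h0
    refine ⟨Pi.single u 1, by simp, fun t ht => Pi.single_eq_of_ne ht 1, ?_⟩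
    rintro _ rfl
    rw [Fintype.sum_eq_single u (fun t ht => by simp [ht]), h0, mul_zero]

theorem eq_or_eq_neg_of_columnsDependent_iff [Fintype S] {a b : Matrix R S ℤ}
    (ha : ∀ r t, a r t ≠ 0 → a r t * a r t = 1) (hb : ∀ r t, b r t ≠ 0 → b r t * b r t = 1)
    (h : ∀ Y Z, ColumnsDependent a Y Z ↔ ColumnsDependent b Y Z) (r : R) (t : S) :
    b r t = a r t ∨ b r t = -a r t := by
  have h1 : a r t = 0 ↔ b r t = 0 := by
    rw [← ColumnsDependent.singleton_iff, h, ColumnsDependent.singleton_iff]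
  by_cases h0 : a r t = 0
  · exact Or.inl (by rw [h0, h1.1 h0])
  · refine mul_self_eq_mul_self_iff.1 ?_
    rw [ha _ _ h0, hb _ _ fun hb0 => h0 (h1.2 hb0)]

theorem columnsDependent_scale_iff [Fintype S] (b : Matrix R S ℤ) (η : R → ℤˣ) (ε : S → ℤˣ)
    (Y : Set R) (Z : Set S) :
    ColumnsDependent (Matrix.of fun r t => (η r * ε t : ℤ) * b r t) Y Z ↔
      ColumnsDependent b Y Z := by
  have hε : ∀ t, (ε t : ℤ) * ε t = 1 := fun t => Int.units_coe_mul_self _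
  constructor
  · rintro ⟨c, hc0, hc, hcr⟩
    refine ⟨fun t => ε t * c t, fun h => hc0 (funext fun t => ?_), fun t ht => ?_,
      fun r hr => ?_⟩
    · exact (mul_eq_zero.1 (congr_fun h t)).resolve_left (ε t).ne_zero
    · simp [hc t ht]
    · have h1 := hcr r hr
      have h2 : ∑ t, c t * (Matrix.of fun r t => (η r * ε t : ℤ) * b r t) r t =
          η r * ∑ t, ε t * c t * b r t := by
        rw [Finset.mul_sum]
        refine Finset.sum_congr rfl fun t _ => ?_
        rw [Matrix.of_apply]
        ring
      rw [h2] at h1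
      exact (mul_eq_zero.1 h1).resolve_left (η r).ne_zero
  · rintro ⟨c, hc0, hc, hcr⟩
    refine ⟨fun t => ε t * c t, fun h => hc0 (funext fun t => ?_), fun t ht => ?_,
      fun r hr => ?_⟩
    · exact (mul_eq_zero.1 (congr_fun h t)).resolve_left (ε t).ne_zero
    · simp [hc t ht]
    · have h2 : ∀ t, ε t * c t * (Matrix.of fun r t => (η r * ε t : ℤ) * b r t) r t =
          η r * (c t * b r t) := by
        intro t
        rw [Matrix.of_apply]
        linear_combination (c t * η r * b r t) * hε t
      rw [Finset.sum_congr rfl fun t _ => h2 t, ← Finset.mul_sum, hcr r hr, mul_zero]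

theorem exists_sign_of_agree_of_columnsDependent_iff [Fintype S] {a b : Matrix R S ℤ} {X : Set S}
    {u : S} (ha : ∀ r t, a r t ≠ 0 → a r t * a r t = 1)
    (h : ∀ Y Z, ColumnsDependent a Y Z ↔ ColumnsDependent b Y Z)
    (hab : ∀ t ∈ X, ∀ r, a r t = b r t) (huX : u ∉ X)
    (hbu : ∀ r, b r u = a r u ∨ b r u = -a r u) :
    ∃ (η : R → ℤˣ) (ε : S → ℤˣ), ∀ t ∈ insert u X, ∀ r, a r t = η r * ε t * b r t := by
  classical
  have hbad := not_exists_isRowChain_of_ratio_ne ha h hab huX hbu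
  -- Rows connected through `X` to a row with ratio `-1`; exactly these are negated. Rows sharing a
  -- column of `X` agree on `P`, so `ε` can undo the change on that column, while column `u` keeps
  -- `ε = 1`.
  let P : R → Prop := fun x => ∃ k r s, IsRowChain a X k r s ∧ r 0 = x ∧
    a (r k) u ≠ 0 ∧ b (r k) u = -a (r k) u
  have hP : ∀ x y, ∀ t ∈ X, a x t ≠ 0 → a y t ≠ 0 → P x → P y := by
    rintro x y t ht hx hy ⟨k, r, s, hch, rfl, hk, hk'⟩
    refine ⟨k + 1, fun n => n.casesOn y r, fun n => n.casesOn t s, ?_, rfl, hk, hk'⟩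
    rintro (_ | j) hj
    · exact ⟨ht, hy, hx⟩
    · exact hch j (by omega)
  let η : R → ℤˣ := fun x => if P x then -1 else 1
  let ε : S → ℤˣ := fun t => if h : t ∈ X ∧ ∃ x, a x t ≠ 0 then η h.2.choose else 1
  refine ⟨η, ε, ?_⟩
  rintro t (rfl | ht) r
  · have hεt : ε t = 1 := dif_neg fun hh => huX hh.1
    rw [hεt]
    by_cases h0 : a r t = 0
    · have : b r t = 0 := by simpa [h0] using hbu r
      rw [h0, this, mul_zero]
    obtain h1 | h1 := hbu r
    · have : ¬ P r := by
        rintro ⟨k, r', s, hch, rfl, hk, hk'⟩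
        exact hbad ⟨k, r', s, hch, h0, h1, hk, hk'⟩
      simp [η, this, h1]
    · have : P r := ⟨0, fun _ => r, fun _ => t, fun j hj => absurd hj (by omega), rfl, h0, h1⟩
      simp [η, this, h1]
  · rw [← hab t ht r]
    by_cases h0 : a r t = 0
    · rw [h0, mul_zero]
    · have hh : t ∈ X ∧ ∃ x, a x t ≠ 0 := ⟨ht, r, h0⟩
      have heq : η hh.2.choose = η r := by
        have : P hh.2.choose ↔ P r :=
          ⟨hP _ _ t ht hh.2.choose_spec h0, hP _ _ t ht h0 hh.2.choose_spec⟩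
        simp only [η, this]
      have hεt : ε t = η hh.2.choose := dif_pos hh
      rw [hεt, heq, Int.units_coe_mul_self, one_mul]

/-- Two matrices with entries `0, ±1` and the same vanishing minors differ only by the signs of
their rows and columns. -/
theorem exists_sign_of_columnsDependent_iff [Fintype S] {a b : Matrix R S ℤ}
    (ha : ∀ r t, a r t ≠ 0 → a r t * a r t = 1) (hb : ∀ r t, b r t ≠ 0 → b r t * b r t = 1)
    (h : ∀ Y Z, ColumnsDependent a Y Z ↔ ColumnsDependent b Y Z) :
    ∃ (η : R → ℤˣ) (ε : S → ℤˣ), ∀ r t, a r t = η r * ε t * b r t := by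
  classical
  suffices H : ∀ X : Finset S, ∃ (η : R → ℤˣ) (ε : S → ℤˣ),
      ∀ t ∈ (X : Set S), ∀ r, a r t = η r * ε t * b r t by
    obtain ⟨η, ε, hηε⟩ := H Finset.univ
    exact ⟨η, ε, fun r t => hηε t (by simp) r⟩
  intro X
  induction X using Finset.induction_on with
  | empty => exact ⟨1, 1, by simp⟩
  | insert u X hu ih =>
    obtain ⟨η, ε, hηε⟩ := ih
    have h' : ∀ Y Z, ColumnsDependent a Y Z ↔
        ColumnsDependent (Matrix.of fun r t => (η r * ε t : ℤ) * b r t) Y Z := fun Y Z => by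
      rw [h, columnsDependent_scale_iff]
    obtain ⟨η', ε', h2⟩ := exists_sign_of_agree_of_columnsDependent_iff (X := X) (u := u) ha h'
      hηε (by simpa using hu) fun r => by
        rw [Matrix.of_apply]
        obtain h1 | h1 := eq_or_eq_neg_of_columnsDependent_iff ha hb h r u <;>
        obtain h3 | h3 := Int.units_eq_one_or (η r) <;>
        obtain h4 | h4 := Int.units_eq_one_or (ε u) <;> simp [h1, h3, h4]
    refine ⟨η' * η, ε' * ε, fun t ht r => ?_⟩
    rw [h2 t (by simpa using ht) r, Matrix.of_apply]
    push_cast [Pi.mul_apply]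
    ring

end Matrix

/-! ### Unimodular representations -/

namespace Matrix

variable {V W E : Type*} [Fintype V] [Fintype W] [Fintype E]

/-- The columns of `D` represent the independence predicate `P` unimodularly: the columns in an
independent set have a dual system of integral functionals, and the columns in a dependent set
satisfy a nontrivial relation with coefficients `0, ±1`. -/
structure IsUnimodularRep (D : Matrix V E ℤ) (P : Set E → Prop) : Prop where
  exists_potential : ∀ I, P I → ∀ f : E → ℤ, ∃ p : V → ℤ, ∀ e ∈ I, (p ᵥ* D) e = f e
  exists_circuit : ∀ I, ¬ P I → ∃ x : E → ℤ, x ≠ 0 ∧ D *ᵥ x = 0 ∧ (∀ e ∉ I, x e = 0) ∧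
    ∀ e, x e ≠ 0 → x e * x e = 1

namespace IsUnimodularRep

variable {D : Matrix V E ℤ} {D' : Matrix W E ℤ} {P : Set E → Prop} {I T : Set E}

/-- The functional equal to `1` at `e` and `0` on the rest of `I` pairs with `x` to give `x e`, yet
annihilates the kernel. -/
theorem eq_zero (h : D.IsUnimodularRep P) (hI : P I) {x : E → ℤ} (hx : D *ᵥ x = 0)
    (hxI : ∀ e ∉ I, x e = 0) : x = 0 := by
  classical
  ext e
  by_cases he : e ∈ I
  · obtain ⟨p, hp⟩ := h.exists_potential I hI (Pi.single e 1)
    have h1 : (p ᵥ* D) ⬝ᵥ x = 0 := by rw [← dotProduct_mulVec, hx, dotProduct_zero]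
    rw [dotProduct, Fintype.sum_eq_single e, hp e he] at h1
    · simpa using h1
    · intro e' hne
      by_cases he' : e' ∈ I
      · rw [hp e' he', Pi.single_eq_of_ne hne, zero_mul]
      · rw [hxI e' he', mul_zero]
  · exact hxI e he

theorem exists_maximal (h : D.IsUnimodularRep P) : ∃ T, Maximal P T := by
  have h0 : P ∅ := by
    by_contra h0
    obtain ⟨x, hx0, -, hx, -⟩ := h.exists_circuit ∅ h0
    exact hx0 (funext fun e => hx e (by simp))
  exact (Set.toFinite {I | P I}).exists_maximal ⟨∅, h0⟩

/-- By maximality `insert s T` supports a circuit. Its entry at `s` is nonzero, since otherwise it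
would be a relation on `T`; multiplying by this sign normalizes it to `1`. -/
theorem exists_fundamentalCircuit (h : D.IsUnimodularRep P) (hT : Maximal P T) {s : E}
    (hs : s ∉ T) : ∃ z : E → ℤ, D *ᵥ z = 0 ∧ z s = 1 ∧ (∀ t ∉ T, t ≠ s → z t = 0) ∧
      ∀ e, z e ≠ 0 → z e * z e = 1 := by
  have hP : ¬ P (insert s T) := fun hP =>
    hs (hT.2 hP (Set.subset_insert s T) (Set.mem_insert s T))
  obtain ⟨x, hx0, hx, hxI, hx1⟩ := h.exists_circuit _ hP
  have hxs : x s ≠ 0 := fun hxs => hx0 <| h.eq_zero hT.1 hx fun e he => by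
    by_cases hes : e = s
    · rw [hes, hxs]
    · exact hxI e (by simp [he, hes])
  refine ⟨x s • x, by rw [mulVec_smul, hx, smul_zero], hx1 s hxs, fun t ht hts => ?_,
    fun e he => ?_⟩
  · simp [hxI t (by simp [ht, hts])]
  · simp only [Pi.smul_apply, smul_eq_mul] at he ⊢
    linear_combination (x e * x e) * hx1 s hxs + hx1 e (right_ne_zero_of_mul he)

open Classical in
/-- The kernel of a unimodular representation is the graph of a matrix with entries `0, ±1`. -/
theorem exists_fundamentalMatrix (h : D.IsUnimodularRep P) (hT : Maximal P T) :
    ∃ a : Matrix T {e // e ∉ T} ℤ, (∀ r t, a r t ≠ 0 → a r t * a r t = 1) ∧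
      ∀ x : E → ℤ, D *ᵥ x = 0 ↔ ∀ r : T, x r = ∑ t : {e // e ∉ T}, x t * a r t := by
  choose z hz hz1 hz0 hzsq using fun t : {e // e ∉ T} => h.exists_fundamentalCircuit hT t.2
  have hker : ∀ x : E → ℤ, D *ᵥ (∑ t : {e // e ∉ T}, x t • z t) = 0 := fun x => by
    rw [mulVec_sum]
    exact Finset.sum_eq_zero fun t _ => by rw [mulVec_smul, hz, smul_zero]
  have hoff : ∀ (x : E → ℤ) (e : E), e ∉ T → (∑ t : {e // e ∉ T}, x t • z t) e = x e := by
    intro x e he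
    rw [Finset.sum_apply, Fintype.sum_eq_single ⟨e, he⟩]
    · simp [hz1 ⟨e, he⟩]
    · intro t ht
      simp [hz0 t e he fun h => ht (Subtype.ext h.symm)]
  refine ⟨Matrix.of fun r t => z t r, fun r t => hzsq t r, fun x => ⟨fun hx r => ?_, fun hx => ?_⟩⟩
  · have h0 := h.eq_zero hT.1 (x := x - ∑ t : {e // e ∉ T}, x t • z t)
      (by rw [mulVec_sub, hx, hker, sub_zero])
      (fun e he => by rw [Pi.sub_apply, hoff x e he, sub_self])
    have h1 := congr_fun (sub_eq_zero.1 h0) r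
    simpa [Finset.sum_apply] using h1
  · have : x = ∑ t : {e // e ∉ T}, x t • z t := by
      ext e
      by_cases he : e ∈ T
      · rw [hx ⟨e, he⟩]
        simp [Finset.sum_apply]
      · rw [hoff x e he]
    rw [this]
    exact hker x

-- A kernel vector is freely given by its coordinates off `T`. Vanishing on the rows `Y` with
-- coefficients in `Z` means being supported on `(T \ Y) ∪ Z`, so the dependences of `a` can be read
-- off from `P`.
open Classical in
theorem columnsDependent_iff (h : D.IsUnimodularRep P) {a : Matrix T {e // e ∉ T} ℤ}
    (ha : ∀ x : E → ℤ, D *ᵥ x = 0 ↔ ∀ r : T, x r = ∑ t : {e // e ∉ T}, x t * a r t)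
    (Y : Set T) (Z : Set {e // e ∉ T}) :
    ColumnsDependent a Y Z ↔
      ¬ P {e | (∀ h : e ∈ T, ⟨e, h⟩ ∉ Y) ∧ ∀ h : e ∉ T, ⟨e, h⟩ ∈ Z} := by
  constructor
  · rintro ⟨c, hc0, hc, hcr⟩ hP
    let x : E → ℤ := fun e => if h : e ∈ T then ∑ t, c t * a ⟨e, h⟩ t else c ⟨e, h⟩
    have hxT : ∀ r : T, x r = ∑ t, c t * a r t := fun r => dif_pos r.2
    have hxS : ∀ t : {e // e ∉ T}, x t = c t := fun t => dif_neg t.2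
    refine hc0 (funext fun t => ?_)
    rw [← hxS, h.eq_zero hP (x := x) ((ha x).2 fun r => ?_) fun e he => ?_]
    · rfl
    · rw [hxT]
      simp only [hxS]
    · by_contra hne
      refine he ⟨fun hT hY => hne ?_, fun hT => ?_⟩
      · rw [hxT ⟨e, hT⟩, hcr _ hY]
      · by_contra hZ
        exact hne (by rw [hxS ⟨e, hT⟩, hc _ hZ])
  · intro hP
    obtain ⟨x, hx0, hx, hxI, -⟩ := h.exists_circuit _ hP
    rw [ha] at hx
    refine ⟨fun t => x t, fun hc => hx0 (funext fun e => ?_), fun t ht => ?_, fun r hr => ?_⟩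
    · by_cases he : e ∈ T
      · rw [hx ⟨e, he⟩]
        exact Finset.sum_eq_zero fun t _ => by rw [congr_fun hc t]; exact zero_mul _
      · exact congr_fun hc ⟨e, he⟩
    · exact hxI t fun hmem => ht (hmem.2 t.2)
    · rw [← hx]
      exact hxI r fun hmem => hmem.1 r.2 hr

/-- Unimodular representations of the same matroid have the same kernel up to signs. -/
theorem exists_sign (h : D.IsUnimodularRep P) (h' : D'.IsUnimodularRep P) :
    ∃ σ : E → ℤˣ, ∀ x : E → ℤ, D *ᵥ x = 0 ↔ D' *ᵥ (fun e => σ e * x e) = 0 := by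
  classical
  obtain ⟨T, hT⟩ := h.exists_maximal
  obtain ⟨a, ha1, ha⟩ := h.exists_fundamentalMatrix hT
  obtain ⟨b, hb1, hb⟩ := h'.exists_fundamentalMatrix hT
  obtain ⟨η, ε, hηε⟩ := exists_sign_of_columnsDependent_iff ha1 hb1 fun Y Z => by
    rw [h.columnsDependent_iff ha, h'.columnsDependent_iff hb]
  -- Basis elements index rows and the others index columns, so the row and column signs together
  -- form one sign per element.
  let σ : E → ℤˣ := fun e => if he : e ∈ T then η ⟨e, he⟩ else ε ⟨e, he⟩
  have hσT : ∀ r : T, σ r = η r := fun r => dif_pos r.2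
  have hσS : ∀ t : {e // e ∉ T}, σ t = ε t := fun t => dif_neg t.2
  refine ⟨σ, fun x => ?_⟩
  rw [ha, hb]
  refine forall_congr' fun r => ?_
  have hη := Int.units_coe_mul_self (η r)
  have hsum : ∑ t : {e // e ∉ T}, x t * a r t =
      η r * ∑ t : {e // e ∉ T}, (σ t * x t) * b r t := by
    rw [Finset.mul_sum]
    refine Finset.sum_congr rfl fun t _ => ?_
    rw [hηε, hσS]
    ring
  rw [hsum, hσT]
  constructor
  · intro hx
    linear_combination (η r : ℤ) * hx + (∑ t : {e // e ∉ T}, (σ t * x t) * b r t) * hη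
  · intro hx
    linear_combination (η r : ℤ) * hx - x r * hη

/-- The row lattice of a unimodular representation is the orthogonal complement of the kernel. -/
theorem mem_range_transpose_iff (h : D.IsUnimodularRep P) {x : E → ℤ} :
    x ∈ LinearMap.range Dᵀ.mulVecLin ↔ ∀ c : E → ℤ, D *ᵥ c = 0 → x ⬝ᵥ c = 0 := by
  constructor
  · rintro ⟨p, rfl⟩ c hc
    rw [mulVecLin_apply, mulVec_transpose, ← dotProduct_mulVec, hc, dotProduct_zero]
  · intro hx
    obtain ⟨T, hT⟩ := h.exists_maximal
    obtain ⟨p, hp⟩ := h.exists_potential T hT.1 x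
    refine ⟨p, ?_⟩
    rw [mulVecLin_apply, mulVec_transpose]
    ext s
    by_cases hs : s ∈ T
    · exact hp s hs
    obtain ⟨z, hz, hz1, hz0, -⟩ := h.exists_fundamentalCircuit hT hs
    -- The difference vanishes on `T`, and off `T` the circuit `z` is supported at `s` alone, so the
    -- pairing is the difference at `s`.
    have h0 : (x - p ᵥ* D) ⬝ᵥ z = 0 := by
      rw [sub_dotProduct, hx z hz, ← dotProduct_mulVec, hz, dotProduct_zero, sub_zero]
    rw [dotProduct, Fintype.sum_eq_single s, hz1, mul_one, Pi.sub_apply, sub_eq_zero] at h0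
    · exact h0.symm
    · intro t hts
      by_cases ht : t ∈ T
      · rw [Pi.sub_apply, hp t ht, sub_self, zero_mul]
      · rw [hz0 t ht hts, mul_zero]

/-- The column lattice of a unimodular representation is saturated. -/
theorem mem_range_of_smul_mem (h : D.IsUnimodularRep P) {n : ℤ} (hn : n ≠ 0) {v : V → ℤ}
    (hv : n • v ∈ LinearMap.range D.mulVecLin) : v ∈ LinearMap.range D.mulVecLin := by
  classical
  obtain ⟨T, hT⟩ := h.exists_maximal
  obtain ⟨x, hx⟩ := hv
  rw [mulVecLin_apply] at hx
  choose z hz hz1 hz0 _ using fun t : {e // e ∉ T} => h.exists_fundamentalCircuit hT t.2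
  -- Subtracting fundamental circuits moves the preimage onto `T`. There the dual functionals give
  -- `y e = p e ⬝ᵥ (n • v)`, so `y` is divisible by `n`.
  obtain ⟨y, hy, hyT⟩ : ∃ y, D *ᵥ y = n • v ∧ ∀ e ∉ T, y e = 0 := by
    refine ⟨x - ∑ t : {e // e ∉ T}, x t • z t, ?_, fun e he => ?_⟩
    · rw [mulVec_sub, mulVec_sum, Finset.sum_eq_zero, sub_zero, hx]
      intro t _
      rw [mulVec_smul, hz, smul_zero]
    · rw [Pi.sub_apply, Finset.sum_apply, Fintype.sum_eq_single ⟨e, he⟩]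
      · simp [hz1 ⟨e, he⟩]
      · intro t ht
        simp [hz0 t e he fun h => ht (Subtype.ext h.symm)]
  choose p hp using fun e : E => h.exists_potential T hT.1 (Pi.single e 1)
  let w : E → ℤ := fun e => if e ∈ T then p e ⬝ᵥ v else 0
  have hw : n • w = y := by
    ext e
    by_cases he : e ∈ T
    · have h1 : (p e ᵥ* D) ⬝ᵥ y = y e := by
        rw [dotProduct, Fintype.sum_eq_single e, hp e e he, Pi.single_eq_same, one_mul]
        intro t hte
        by_cases ht : t ∈ T
        · rw [hp e t ht, Pi.single_eq_of_ne hte, zero_mul]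
        · rw [hyT t ht, mul_zero]
      rw [← h1, ← dotProduct_mulVec, hy, dotProduct_smul]
      simp [w, he]
    · simp [w, he, hyT e he]
  refine ⟨w, ?_⟩
  rw [mulVecLin_apply]
  refine smul_right_injective (V → ℤ) hn ?_
  change n • (D *ᵥ w) = n • v
  rw [← mulVec_smul, hw, hy]

end IsUnimodularRep

/-! ### Torsion of cokernels -/

/-- An injective homomorphism whose image contains all torsion elements restricts to an isomorphism
of the torsion subgroups. -/
theorem _root_.AddCommGroup.nonempty_torsion_addEquiv {A B : Type*} [AddCommGroup A]
    [AddCommGroup B] (f : A →+ B) (hf : Function.Injective f)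
    (hr : ∀ b ∈ AddCommGroup.torsion B, ∃ a, f a = b) :
    Nonempty (AddCommGroup.torsion A ≃+ AddCommGroup.torsion B) := by
  have hmem : ∀ a, f a ∈ AddCommGroup.torsion B ↔ a ∈ AddCommGroup.torsion A := fun a =>
    hf.isOfFinAddOrder_iff
  let g : AddCommGroup.torsion A →+ AddCommGroup.torsion B :=
    (f.comp (AddCommGroup.torsion A).subtype).codRestrict _ fun a => (hmem a).2 a.2
  refine ⟨AddEquiv.ofBijective g ⟨fun a b hab => ?_, fun b => ?_⟩⟩
  · exact Subtype.ext (hf (congr_arg Subtype.val hab))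
  · obtain ⟨a, ha⟩ := hr b b.2
    exact ⟨⟨a, (hmem a).1 (ha ▸ b.2)⟩, Subtype.ext ha⟩

namespace IsUnimodularRep

variable {D : Matrix V E ℤ} {D' : Matrix W E ℤ} {P : Set E → Prop}

/-- The map induced by `D` is injective because `ker D + im Dᵀ` is the preimage of `im (D * Dᵀ)`. It
reaches all torsion: a multiple of a torsion representative lies in `im D`, which is saturated. -/
theorem nonempty_torsion_addEquiv (h : D.IsUnimodularRep P) :
    Nonempty (AddCommGroup.torsion
        ((E → ℤ) ⧸ LinearMap.ker D.mulVecLin ⊔ LinearMap.range Dᵀ.mulVecLin) ≃+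
      AddCommGroup.torsion ((V → ℤ) ⧸ LinearMap.range (D * Dᵀ).mulVecLin)) := by
  have hle : LinearMap.ker D.mulVecLin ⊔ LinearMap.range Dᵀ.mulVecLin =
      (LinearMap.range (D * Dᵀ).mulVecLin).comap D.mulVecLin := by
    rw [mulVecLin_mul, LinearMap.range_comp, Submodule.comap_map_eq, sup_comm]
  refine AddCommGroup.nonempty_torsion_addEquiv
    (Submodule.mapQ _ _ D.mulVecLin hle.le).toAddMonoidHom ?_ ?_
  · change Function.Injective (Submodule.mapQ _ _ D.mulVecLin hle.le)
    rw [← LinearMap.ker_eq_bot, Submodule.mapQ, Submodule.ker_liftQ_eq_bot]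
    rw [LinearMap.ker_comp, Submodule.ker_mkQ, hle]
  · intro b hb
    obtain ⟨v, rfl⟩ := Submodule.Quotient.mk_surjective _ b
    obtain ⟨n, hn, hnv⟩ := isOfFinAddOrder_iff_nsmul_eq_zero.1 hb
    rw [← Submodule.Quotient.mk_smul, Submodule.Quotient.mk_eq_zero, mulVecLin_mul] at hnv
    obtain ⟨x, rfl⟩ := h.mem_range_of_smul_mem (n := n) (by omega) (v := v) (by
      rw [natCast_zsmul]
      exact LinearMap.range_comp_le_range _ _ hnv)
    exact ⟨Submodule.Quotient.mk x, rfl⟩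

/-- The torsion of the cokernel of the Gram matrix depends only on the represented matroid. -/
theorem nonempty_torsion_coker_addEquiv (h : D.IsUnimodularRep P) (h' : D'.IsUnimodularRep P) :
    Nonempty (AddCommGroup.torsion ((V → ℤ) ⧸ LinearMap.range (D * Dᵀ).mulVecLin) ≃+
      AddCommGroup.torsion ((W → ℤ) ⧸ LinearMap.range (D' * D'ᵀ).mulVecLin)) := by
  obtain ⟨σ, hσ⟩ := h.exists_sign h'
  let L : (E → ℤ) ≃ₗ[ℤ] (E → ℤ) := LinearEquiv.piCongrRight fun e => LinearEquiv.smulOfUnit (σ e)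
  have hL : ∀ x, L x = fun e => σ e * x e := fun x => rfl
  have hLL : ∀ x, L (L x) = x := fun x => by
    ext e
    simp only [hL]
    rw [← mul_assoc, Int.units_coe_mul_self, one_mul]
  have hdot : ∀ x y, L x ⬝ᵥ y = x ⬝ᵥ L y := fun x y => by
    simp only [hL, dotProduct]
    exact Finset.sum_congr rfl fun e _ => by ring
  -- `L` is a self-adjoint involution exchanging the two kernels, hence also their orthogonal
  -- complements, which are the row lattices.
  have hmap : (LinearMap.ker D.mulVecLin ⊔ LinearMap.range Dᵀ.mulVecLin).map
      (L : (E → ℤ) →ₗ[ℤ] (E → ℤ)) =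
      LinearMap.ker D'.mulVecLin ⊔ LinearMap.range D'ᵀ.mulVecLin := by
    have hmem : ∀ (S : Submodule ℤ (E → ℤ)) (x : E → ℤ),
        x ∈ S.map (L : (E → ℤ) →ₗ[ℤ] (E → ℤ)) ↔ L x ∈ S := fun S x => by
      refine ⟨?_, fun hx => ⟨L x, hx, hLL x⟩⟩
      rintro ⟨y, hy, rfl⟩
      simpa [hLL y] using hy
    rw [Submodule.map_sup]
    congr 1
    · ext x
      rw [hmem, LinearMap.mem_ker, LinearMap.mem_ker, mulVecLin_apply, mulVecLin_apply, hσ,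
        ← hL, hLL]
    · ext x
      rw [hmem, h.mem_range_transpose_iff, h'.mem_range_transpose_iff]
      refine ⟨fun hx c hc => ?_, fun hx c hc => ?_⟩
      · rw [← hLL c, ← hdot]
        exact hx _ ((hσ _).2 (by rw [← hL, hLL]; exact hc))
      · rw [hdot]
        exact hx _ ((hσ c).1 hc)
  obtain ⟨e1⟩ := h.nonempty_torsion_addEquiv
  obtain ⟨e2⟩ := h'.nonempty_torsion_addEquiv
  let q := (Submodule.Quotient.equiv _ _ L hmap).toAddEquiv
  obtain ⟨e3⟩ := AddCommGroup.nonempty_torsion_addEquiv q.toAddMonoidHom q.injective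
    fun b _ => q.surjective b
  exact ⟨e1.symm.trans (e3.trans e2)⟩

end IsUnimodularRep

end Matrix

/-! ### The graphic matroid and the Laplacian -/

namespace Graph

variable {α β E : Type*} {G : Graph α β}

theorem exists_leaf_of_isForest {I : Set β} (hI : G.IsForest I) (hfin : I.Finite)
    (hne : I.Nonempty) :
    ∃ a ∈ I, ∃ x y, G.IsLink a x y ∧ x ≠ y ∧ ∀ b ∈ I, b ≠ a → ¬ G.Inc b y := by
  by_contra! hcon
  obtain ⟨C, hC, hcyc⟩ := exists_isCycleSet_of_forall_exists_ne hfin hne hI.1 hcon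
  exact hI.2 C hC hcyc

theorem IsForest.subset {I J : Set β} (hJ : G.IsForest J) (h : I ⊆ J) : G.IsForest I :=
  ⟨h.trans hJ.1, fun C hC => hJ.2 C (hC.trans h)⟩

/-- Every function on the edges of a forest is the difference of a potential on the vertices. -/
theorem exists_potential_of_isForest [Finite E] {ι : E → β} (hι : Function.Injective ι)
    {src tgt : E → α} (hlink : ∀ e, G.IsLink (ι e) (src e) (tgt e)) (f : E → ℤ) (I : Set E)
    (hI : G.IsForest (ι '' I)) :
    ∃ p : α → ℤ, ∀ e ∈ I, p (tgt e) - p (src e) = f e := by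
  classical
  induction I using WellFoundedLT.induction with
  | ind I ih =>
    rcases I.eq_empty_or_nonempty with rfl | hne
    · exact ⟨0, by simp⟩
    obtain ⟨_, ⟨a, ha, rfl⟩, x, y, hxy, hne, hleaf⟩ :=
      exists_leaf_of_isForest hI (Set.toFinite _) (hne.image ι)
    obtain ⟨p, hp⟩ := ih (I \ {a}) (Set.sdiff_singleton_ssubset.2 ha)
      (hI.subset (Set.image_mono Set.sdiff_subset))
    have hends : ∀ e ∈ I, e ≠ a → tgt e ≠ y ∧ src e ≠ y := by
      intro e he hea
      have := hleaf _ ⟨e, he, rfl⟩ (hι.ne hea)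
      exact ⟨fun h => this (h ▸ (hlink e).inc_right), fun h => this (h ▸ (hlink e).inc_left)⟩
    -- The leaf `y` meets no other edge of `I`, so its potential can be reset to fit `a`; the sign
    -- depends on the orientation of `a`.
    obtain ⟨c, hc⟩ : ∃ c : ℤ, Function.update p y c (tgt a) - Function.update p y c (src a) =
        f a := by
      obtain ⟨h1, h2⟩ | ⟨h1, h2⟩ := (hlink a).eq_and_eq_or_eq_and_eq hxy
      · refine ⟨p x + f a, ?_⟩
        rw [h1, h2, Function.update_self, Function.update_of_ne hne]
        ring
      · refine ⟨p x - f a, ?_⟩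
        rw [h1, h2, Function.update_self, Function.update_of_ne hne]
        ring
    refine ⟨Function.update p y c, fun e he => ?_⟩
    by_cases hea : e = a
    · rw [hea, hc]
    · rw [Function.update_of_ne (hends e he hea).1, Function.update_of_ne (hends e he hea).2]
      exact hp e ⟨he, hea⟩

/-! ### The incidence matrix as a unimodular representation -/

open Classical in
/-- The incidence matrix of the directed graph with sources `src` and targets `tgt`. -/
noncomputable def orientedIncMatrix {V : Type*} (src tgt : E → V) : Matrix V E ℤ :=
  Matrix.of fun v e => (if v = tgt e then 1 else 0) - (if v = src e then 1 else 0)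

section

variable {V : Type*} [Fintype V]

open Classical in
theorem vecMul_orientedIncMatrix (src tgt : E → V) (p : V → ℤ) (e : E) :
    Matrix.vecMul p (orientedIncMatrix src tgt) e = p (tgt e) - p (src e) := by
  simp [Matrix.vecMul, dotProduct, orientedIncMatrix, mul_sub, Finset.sum_sub_distrib]

theorem sum_orientedIncMatrix (src tgt : E → V) (e : E) :
    ∑ v, orientedIncMatrix src tgt v e = 0 := by
  classical
  simp [orientedIncMatrix, Finset.sum_sub_distrib]

end

/-- The signed characteristic vector of a cycle lies in the kernel of the incidence matrix. -/
theorem exists_circuit_of_not_isForest [Fintype E] (φ : E ≃ G.edgeSet)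
    {src tgt : E → G.vertexSet} (hlink : ∀ e, G.IsLink (φ e) (src e) (tgt e)) {I : Set E}
    (hI : ¬ G.IsForest (Subtype.val '' (φ '' I))) :
    ∃ x : E → ℤ, x ≠ 0 ∧ Matrix.mulVec (orientedIncMatrix src tgt) x = 0 ∧
      (∀ e ∉ I, x e = 0) ∧ ∀ e, x e ≠ 0 → x e * x e = 1 := by
  classical
  have hE : Subtype.val '' (φ '' I) ⊆ G.edgeSet := by
    rintro _ ⟨e, -, rfl⟩
    exact e.2
  simp only [IsForest, hE, true_and, not_forall, not_not] at hI
  obtain ⟨C, hC, k, v, e, hv, he, hl, rfl⟩ := hI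
  have hmem : ∀ i, ∃ a ∈ I, ((φ a : G.edgeSet) : β) = e i := fun i => by
    obtain ⟨_, ⟨a, ha, rfl⟩, h⟩ := hC ⟨i, rfl⟩
    exact ⟨a, ha, h⟩
  choose a haI hae using hmem
  have ha : Function.Injective a := fun i j hij => he (by rw [← hae i, ← hae j, hij])
  let w : Fin (k + 1) → G.vertexSet := fun i => ⟨v i, (hl i).left_mem⟩
  -- The sign records whether the chosen orientation agrees with the direction of the cycle. The
  -- signed columns then telescope around the cycle.
  have hor : ∀ i, ∃ c : ℤ, c * c = 1 ∧ ∀ u, orientedIncMatrix src tgt u (a i) * c =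
      (Pi.single (w (i + 1)) 1 : G.vertexSet → ℤ) u - (Pi.single (w i) 1 : G.vertexSet → ℤ) u := by
    intro i
    have h1 := hlink (a i)
    rw [hae] at h1
    obtain ⟨h2, h3⟩ | ⟨h2, h3⟩ := h1.eq_and_eq_or_eq_and_eq (hl i)
    · have h2' : src (a i) = w i := Subtype.ext h2
      have h3' : tgt (a i) = w (i + 1) := Subtype.ext h3
      exact ⟨1, by norm_num, fun u => by simp [orientedIncMatrix, h2', h3', Pi.single_apply]⟩
    · have h2' : src (a i) = w (i + 1) := Subtype.ext h2
      have h3' : tgt (a i) = w i := Subtype.ext h3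
      exact ⟨-1, by norm_num, fun u => by simp [orientedIncMatrix, h2', h3', Pi.single_apply]⟩
  choose c hc hcD using hor
  let x : E → ℤ := ∑ i, Pi.single (a i) (c i)
  have hxa : ∀ i, x (a i) = c i := fun i => by
    simp only [x, Finset.sum_apply]
    rw [Fintype.sum_eq_single i fun j hj => Pi.single_eq_of_ne (ha.ne hj.symm) _,
      Pi.single_eq_same]
  have hx0 : ∀ e, (∀ i, a i ≠ e) → x e = 0 := fun e he => by
    simp only [x, Finset.sum_apply]
    exact Finset.sum_eq_zero fun i _ => Pi.single_eq_of_ne (he i).symm _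
  refine ⟨x, fun h => ?_, ?_, fun e heI => hx0 e ?_, fun e hxe => ?_⟩
  · have h0 := hc 0
    rw [← hxa, h] at h0
    simp at h0
  · ext u
    simp only [x, Matrix.mulVec_sum, Finset.sum_apply, Matrix.mulVec_single, Pi.zero_apply]
    have h1 : ∀ i, (MulOpposite.op (c i) • (orientedIncMatrix src tgt).col (a i)) u =
        (Pi.single (w (i + 1)) 1 : G.vertexSet → ℤ) u - (Pi.single (w i) 1 : G.vertexSet → ℤ) u :=
      fun i => hcD i u
    rw [Finset.sum_congr rfl fun i _ => h1 i, Finset.sum_sub_distrib, sub_eq_zero]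
    exact Equiv.sum_comp (Equiv.addRight (1 : Fin (k + 1)))
      fun i => (Pi.single (w i) 1 : G.vertexSet → ℤ) u
  · rintro i rfl
    exact heI (haI i)
  · obtain ⟨i, rfl⟩ : ∃ i, a i = e := by
      by_contra! hcon
      exact hxe (hx0 e hcon)
    rw [hxa, hc]

/-- Indexing edges through `φ` allows two graphs to be represented on one ground set `E`. -/
theorem isUnimodularRep_orientedIncMatrix [Fintype G.vertexSet] [Fintype E] (φ : E ≃ G.edgeSet)
    {src tgt : E → G.vertexSet} (hlink : ∀ e, G.IsLink (φ e) (src e) (tgt e)) :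
    (orientedIncMatrix src tgt).IsUnimodularRep
      fun I => G.IsForest (Subtype.val '' (φ '' I)) where
  exists_potential I hI f := by
    rw [← Set.image_comp] at hI
    obtain ⟨p, hp⟩ := exists_potential_of_isForest
      (Subtype.val_injective.comp φ.injective) hlink f I hI
    exact ⟨fun v => p v, fun e he => by rw [vecMul_orientedIncMatrix, hp e he]⟩
  exists_circuit I hI := exists_circuit_of_not_isForest φ hlink hI

theorem _root_.Matrix.ext_of_sum_eq_zero {V : Type*} [Fintype V] {A B : Matrix V V ℤ}
    (hA : ∀ x, ∑ y, A x y = 0) (hB : ∀ x, ∑ y, B x y = 0) (h : ∀ x y, x ≠ y → A x y = B x y) :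
    A = B := by
  classical
  ext x y
  by_cases hxy : x = y
  · subst hxy
    have h1 := hA x
    have h2 := hB x
    rw [← Finset.add_sum_erase _ _ (Finset.mem_univ x)] at h1 h2
    rw [Finset.sum_congr rfl fun y hy => h x y (Finset.ne_of_mem_erase hy).symm] at h1
    linarith
  · exact h x y hxy

/-- Both sides have zero row sums, so only off-diagonal entries need comparison: each edge joining
`x` and `y` contributes `-1`. Loops thus never have to be counted. -/
theorem laplacianMatrix_eq [Fintype G.vertexSet] [Fintype E] (φ : E ≃ G.edgeSet)
    {src tgt : E → G.vertexSet} (hlink : ∀ e, G.IsLink (φ e) (src e) (tgt e)) :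
    G.laplacianMatrix =
      orientedIncMatrix src tgt * (orientedIncMatrix src tgt).transpose := by
  classical
  refine Matrix.ext_of_sum_eq_zero (fun x => ?_) (fun x => ?_) fun x y hxy => ?_
  · simp [laplacianMatrix, Matrix.diagonal_apply, Finset.sum_sub_distrib]
  · simp only [Matrix.mul_apply, Matrix.transpose_apply]
    rw [Finset.sum_comm]
    simp only [← Finset.mul_sum, sum_orientedIncMatrix, mul_zero, Finset.sum_const_zero]
  · have hset : {e | G.IsLink e x y} =
        (fun e : E => ((φ e : G.edgeSet) : β)) '' {e | G.IsLink (φ e) x y} := by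
      ext b
      refine ⟨fun hb => ⟨φ.symm ⟨b, hb.edge_mem⟩, by simpa using hb, by simp⟩, ?_⟩
      rintro ⟨e, he, rfl⟩
      exact he
    have hcard : ({e | G.IsLink e x y}.ncard : ℤ) =
        ∑ e : E, if G.IsLink (φ e) x y then 1 else 0 := by
      rw [hset, Set.ncard_image_of_injective _ (fun a b hab => φ.injective (Subtype.ext hab)),
        Set.ncard_eq_toFinset_card', Finset.sum_boole]
      simp
    have hadj : G.laplacianMatrix x y = -({e | G.IsLink e x y}.ncard : ℤ) := by
      simp [laplacianMatrix, adjacencyMatrix, hxy]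
    rw [hadj, hcard, Matrix.mul_apply, ← Finset.sum_neg_distrib]
    refine Finset.sum_congr rfl fun e _ => ?_
    rw [(hlink e).isLink_iff, Subtype.coe_inj, Subtype.coe_inj, Subtype.coe_inj,
      Subtype.coe_inj, Matrix.transpose_apply]
    simp only [orientedIncMatrix, Matrix.of_apply]
    grind

end Graph

/-- Finite undirected multigraphs with isomorphic graphic matroids have isomorphic reduced critical
groups. -/
theorem corollary7p7 {α β α' β' : Type*} (G : Graph α β) (H : Graph α' β')
    [Fintype G.vertexSet] [Fintype H.vertexSet]
    (hG : G.edgeSet.Finite) (hH : H.edgeSet.Finite)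
    (h : G.graphicMatroid.IsIsomorphic H.graphicMatroid) :
    Nonempty (G.ReducedCriticalGroup ≃+ H.ReducedCriticalGroup) := by
  have := hG.fintype
  obtain ⟨φ, hφ⟩ := h
  let φ' : G.edgeSet ≃ H.edgeSet := φ
  choose s t hst using fun e : G.edgeSet => G.exists_isLink_of_mem_edgeSet e.2
  -- The edges of `H` are indexed by those of `G`, so that the matroid isomorphism becomes equality
  -- of the two independence predicates.
  choose s' t' hst' using fun e : G.edgeSet => H.exists_isLink_of_mem_edgeSet (φ' e).2
  let src : G.edgeSet → G.vertexSet := fun e => ⟨s e, (hst e).left_mem⟩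
  let tgt : G.edgeSet → G.vertexSet := fun e => ⟨t e, (hst e).right_mem⟩
  let src' : G.edgeSet → H.vertexSet := fun e => ⟨s' e, (hst' e).left_mem⟩
  let tgt' : G.edgeSet → H.vertexSet := fun e => ⟨t' e, (hst' e).right_mem⟩
  have h1 := Graph.isUnimodularRep_orientedIncMatrix (Equiv.refl G.edgeSet) (src := src)
    (tgt := tgt) hst
  have h2 := Graph.isUnimodularRep_orientedIncMatrix φ' (src := src') (tgt := tgt') hst'
  have e1 := Graph.laplacianMatrix_eq (Equiv.refl G.edgeSet) (src := src) (tgt := tgt) hst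
  have e2 := Graph.laplacianMatrix_eq φ' (src := src') (tgt := tgt') hst'
  have hP : (fun I => G.IsForest (Subtype.val '' (Equiv.refl G.edgeSet '' I))) =
      fun I => H.IsForest (Subtype.val '' (φ' '' I)) := by
    funext I
    have h3 := hφ I
    rw [Graph.graphicMatroid_indep, Graph.graphicMatroid_indep] at h3
    rw [Equiv.coe_refl, Set.image_id]
    exact propext h3
  rw [hP] at h1
  have key := h1.nonempty_torsion_coker_addEquiv h2
  have t1 : G.laplacianMatrix.transpose = G.laplacianMatrix := by
    rw [e1, Matrix.transpose_mul, Matrix.transpose_transpose]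
  have t2 : H.laplacianMatrix.transpose = H.laplacianMatrix := by
    rw [e2, Matrix.transpose_mul, Matrix.transpose_transpose]
  unfold Graph.ReducedCriticalGroup Graph.CriticalGroup
  rw [t1, t2, e1, e2]
  exact key
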